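/- Let $L$ be the language of fields, presented relationally by symbols for $\{0\}$, $\{1\}$ and the graphs of addition and multiplication. For $r\in\mathbb{N}$ let $\mathrm{FD}_r$ be the class of all $L$-structures with universe $\omega=\mathbb{N}$ that are fields of characteristic $0$ and of transcendence degree $r$ over $\mathbb{Q}$. Fix an effective coding of the sentences $R(a_1,\dots,a_k)$, where $R$ is a $k$-ary relation symbol of $L$ and $a_1,\dots,a_k\in\omega$, by natural numbers, and identify an $L$-structure $\mathcal{A}$ with universe $\omega$ with its atomic diagram $D(\mathcal{A})\in 2^\omega$, that is, with the characteristic function of the set of codes of those sentences that hold in $\mathcal{A}$. For classes $K,K'$ of such structures, each closed under isomorphism, a Turing-computable embedding of $K$ in $K'$ is a map $\Phi:K\to K'$ such that (i) there is a single oracle Turing machine which, for every $\mathcal{A}\in K$, computes $D(\Phi(\mathcal{A}))$ from the oracle $D(\mathcal{A})$; and (ii) for all $\mathcal{A},\mathcal{B}\in K$, $\mathcal{A}\cong\mathcal{B}$ if and only if $\Phi(\mathcal{A})\cong\Phi(\mathcal{B})$. Write $K\leq_{tc}K'$ if such an embedding exists. Then $\mathrm{FD}_1\not\leq_{tc}\mathrm{FD}_0$: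 there is no Turing-computable embedding of $\mathrm{FD}_1$ in $\mathrm{FD}_0$. -/

import Mathlib

namespace TuringEmbedding

/-! ### Turing functionals -/

/-- Programs for functions `ℕ →. ℕ` with an oracle: the clauses are those of `Nat.RecursiveIn`. -/
inductive OracleCode : Type
  | zero : OracleCode
  | succ : OracleCode
  | left : OracleCode
  | right : OracleCode
  | oracle : OracleCode
  | pair : OracleCode → OracleCode → OracleCode
  | comp : OracleCode → OracleCode → OracleCode
  | prec : OracleCode → OracleCode → OracleCode
  | rfind : OracleCode → OracleCode

/-- The partial function computed by a program with oracle `g`. The program does not depend on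
the oracle, so `g ↦ c.eval g` is a Turing functional. -/
def OracleCode.eval (g : ℕ → ℕ) : OracleCode → ℕ →. ℕ
  | .zero => fun _ => Part.some 0
  | .succ => fun n => Part.some (n + 1)
  | .left => fun n => Part.some n.unpair.1
  | .right => fun n => Part.some n.unpair.2
  | .oracle => fun n => Part.some (g n)
  | .pair c d => fun n => Nat.pair <$> c.eval g n <*> d.eval g n
  | .comp c d => fun n => d.eval g n >>= c.eval g
  | .prec c d => fun p =>
      let (a, n) := Nat.unpair p
      n.rec (c.eval g a) fun y IH => do
        let i ← IH
        d.eval g (Nat.pair a (Nat.pair y i))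
  | .rfind c => fun a => Nat.rfind fun n => (fun m => m = 0) <$> c.eval g (Nat.pair a n)

/-! ### Structures with universe `ℕ` and their atomic diagrams -/

/-- A computable relational language: there are no function symbols, the relation symbols are
effectively coded by natural numbers, and the arity of a symbol is computable from its code. -/
class ComputableRelational (L : FirstOrder.Language.{0, 0}) where
  isRelational : L.IsRelational
  primcodable : Primcodable (Σ n, L.Relations n)
  computable_arity : Computable (fun R : (Σ n, L.Relations n) => R.1)

attribute [instance, reducible] ComputableRelational.primcodable

/-- `Mod L`: the `L`-structures with universe `ℕ`. -/
abbrev Mod (L : FirstOrder.Language.{0, 0}) : Type := L.Structure ℕ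

/-- Isomorphism of structures with universe `ℕ`. -/
def Iso {L : FirstOrder.Language.{0, 0}} (A B : Mod L) : Prop :=
  Nonempty (@FirstOrder.Language.Equiv L ℕ ℕ A B)

open Classical in
/-- The atomic diagram of `A`, as an element of `2^ω`: a number `m` that codes an atomic sentence
`R(a₁, …, aₖ)` (that is, a symbol `R` of arity `k` and a list of `k` natural numbers) is sent to
`1` if the sentence holds in `A` and to `0` otherwise. Numbers that code no atomic sentence, which
form a computable set, are sent to `0`. -/
noncomputable def diagram {L : FirstOrder.Language.{0, 0}} [ComputableRelational L] (A : Mod L) (m : ℕ) : ℕ :=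
  if ∃ (R : Σ n, L.Relations n) (a : Fin R.1 → ℕ),
      m = Encodable.encode (R, List.ofFn a) ∧ A.RelMap R.2 a then 1 else 0

/-- A class of structures that is closed under isomorphism. -/
def IsIsoClosed {L : FirstOrder.Language.{0, 0}} (K : Set (Mod L)) : Prop :=
  ∀ A B : Mod L, Iso A B → A ∈ K → B ∈ K

section Embedding

variable {L L' : FirstOrder.Language.{0, 0}} [ComputableRelational L] [ComputableRelational L']

/-- `Φ : K → K'` is a Turing operator: one oracle program computes the atomic diagram of `Φ A`
from the atomic diagram of `A`, for every `A` in `K`. -/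
def IsTuringOperator {K : Set (Mod L)} {K' : Set (Mod L')} (Φ : K → K') : Prop :=
  ∃ c : OracleCode, ∀ (A : K) (m : ℕ),
    c.eval (diagram A.1) m = Part.some (diagram (Φ A).1 m)

/-- `Φ : K → K'` is a Turing-computable embedding. -/
def IsTCEmbedding {K : Set (Mod L)} {K' : Set (Mod L')} (Φ : K → K') : Prop :=
  IsTuringOperator Φ ∧ ∀ A B : K, Iso A.1 B.1 ↔ Iso (Φ A).1 (Φ B).1

/-- `K ≤_tc K'`: there is a Turing-computable embedding of `K` in `K'`. -/
def TCReducible (K : Set (Mod L)) (K' : Set (Mod L')) : Prop :=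
  ∃ Φ : K → K', IsTCEmbedding Φ

end Embedding

/-! ### Fields of characteristic `0` and transcendence degree `r` -/

/-- Relation symbols for the graphs of the field operations. -/
inductive FieldRel : ℕ → Type
  | zero : FieldRel 1
  | one : FieldRel 1
  | add : FieldRel 3
  | mul : FieldRel 3

/-- The language of fields, in relational form. -/
def fieldLang : FirstOrder.Language.{0, 0} := ⟨fun _ => Empty, FieldRel⟩

/-- The four relation symbols, listed. -/
def fieldSymEquiv : (Σ n, fieldLang.Relations n) ≃ Fin 4 where
  toFun := fun
    | ⟨_, FieldRel.zero⟩ => 0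
    | ⟨_, FieldRel.one⟩ => 1
    | ⟨_, FieldRel.add⟩ => 2
    | ⟨_, FieldRel.mul⟩ => 3
  invFun := ![⟨1, FieldRel.zero⟩, ⟨1, FieldRel.one⟩, ⟨3, FieldRel.add⟩, ⟨3, FieldRel.mul⟩]
  left_inv := by rintro ⟨_, _ | _ | _ | _⟩ <;> rfl
  right_inv := by intro i; fin_cases i <;> rfl

instance : ComputableRelational fieldLang where
  isRelational := fun _ => inferInstanceAs (IsEmpty Empty)
  primcodable := Primcodable.ofEquiv (Fin 4) fieldSymEquiv
  computable_arity := by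
    let _ : Primcodable (Σ n, fieldLang.Relations n) := Primcodable.ofEquiv (Fin 4) fieldSymEquiv
    have : Finite (Σ n, fieldLang.Relations n) := Finite.of_equiv _ fieldSymEquiv.symm
    exact (Primrec.dom_finite _).to_comp

/-- A field, regarded as a structure for the relational language of fields. -/
abbrev fieldStructure (F : Type) [Field F] : fieldLang.Structure F where
  funMap := fun f => Empty.elim f
  RelMap := fun R => match R with
    | FieldRel.zero => fun a => a 0 = 0
    | FieldRel.one => fun a => a 0 = 1
    | FieldRel.add => fun a => a 0 + a 1 = a 2
    | FieldRel.mul => fun a => a 0 * a 1 = a 2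

/-- `FD r`: the structures with universe `ℕ` that are fields of characteristic `0` and of
transcendence degree `r` over `ℚ`. -/
def FD (r : ℕ) : Set (Mod fieldLang) :=
  {A | ∃ (F : Type) (_ : Field F) (_ : CharZero F), Algebra.trdeg ℚ F = r ∧
    Nonempty (@FirstOrder.Language.Equiv fieldLang ℕ F A (fieldStructure F))}

theorem FD_isIsoClosed (r : ℕ) : IsIsoClosed (FD r) := by
  rintro A B ⟨e⟩ ⟨F, hF, hc, hr, ⟨f⟩⟩
  exact ⟨F, hF, hc, hr,
    ⟨@FirstOrder.Language.Equiv.comp _ _ _ B A _ (fieldStructure F) f (@FirstOrder.Language.Equiv.symm _ _ _ A B e)⟩⟩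

end TuringEmbedding

/-! Computability enters only through continuity: a finite piece of `Φ A` depends on a finite piece
of `A` (`OracleCode.eval_use_lt`). Suppose every finite subset of `F` lies in a subfield that embeds
in `G`. Then any finite piece of a copy of `F` is also a piece of a copy of `G`
(`LocallyEmbeds.exists_diagram_eq`). That an integer polynomial has a root is witnessed by a finite
piece of the diagram, so a root in the image of `F` forces one in the image of `G`
(`IsTCEmbedding.exists_root`).

Algebraic extensions of `ℚ` are classified by the integer polynomials with a root in them. Hence an
embedding into `FD 0` must identify fields that locally embed in each other
(`IsTCEmbedding.nonempty_ringEquiv`).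

In transcendence degree one such fields can differ. Adjoining to `ℚ(X)` a chain of iterated square
roots of `X` gives an increasing union of copies of `ℚ(X)`. There `X` has a `2 ^ n`-th root for
every `n`, while in `ℚ(X)` only constants do (`isAlgebraic_of_forall_exists_pow_eq`). -/

namespace TuringEmbedding

/-! ### Continuity of Turing functionals -/

/-- A converging computation uses only finitely many values of its oracle. -/
theorem OracleCode.eval_use (g : ℕ → ℕ) (c : OracleCode) :
    ∀ n v : ℕ, v ∈ c.eval g n →
      ∃ N, ∀ g' : ℕ → ℕ, (∀ i < N, g' i = g i) → v ∈ c.eval g' n := by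
  induction c with
  | zero => intro n v h; exact ⟨0, fun g' _ => by simpa [eval] using h⟩
  | succ => intro n v h; exact ⟨0, fun g' _ => by simpa [eval] using h⟩
  | left => intro n v h; exact ⟨0, fun g' _ => by simpa [eval] using h⟩
  | right => intro n v h; exact ⟨0, fun g' _ => by simpa [eval] using h⟩
  | oracle =>
    intro n v h
    refine ⟨n + 1, fun g' hg => ?_⟩
    simp only [eval, Part.mem_some_iff] at h ⊢
    rw [h, hg n (Nat.lt_succ_self n)]
  | pair c d ihc ihd =>
    intro n v h
    simp only [eval, Seq.seq, Part.map_eq_map, Part.mem_bind_iff, Part.mem_map_iff] at h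
    obtain ⟨f, ⟨a, ha, rfl⟩, b, hb, rfl⟩ := h
    obtain ⟨N, hN⟩ := ihc n a ha
    obtain ⟨M, hM⟩ := ihd n b hb
    refine ⟨max N M, fun g' hg => ?_⟩
    simp only [eval, Seq.seq, Part.map_eq_map, Part.mem_bind_iff, Part.mem_map_iff]
    exact ⟨_, ⟨a, hN g' fun i hi => hg i (lt_max_of_lt_left hi), rfl⟩, b,
      hM g' fun i hi => hg i (lt_max_of_lt_right hi), rfl⟩
  | comp c d ihc ihd =>
    intro n v h
    obtain ⟨a, ha, hv⟩ := Part.mem_bind_iff.1 h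
    obtain ⟨N, hN⟩ := ihd n a ha
    obtain ⟨M, hM⟩ := ihc a v hv
    refine ⟨max N M, fun g' hg => ?_⟩
    exact Part.mem_bind_iff.2 ⟨a, hN g' fun i hi => hg i (lt_max_of_lt_left hi),
      hM g' fun i hi => hg i (lt_max_of_lt_right hi)⟩
  | prec c d ihc ihd =>
    intro p
    simp only [eval]
    generalize p.unpair.1 = a
    generalize p.unpair.2 = n
    induction n with
    | zero => exact ihc a
    | succ y ih =>
      intro v h
      simp only [Part.bind_eq_bind, Part.mem_bind_iff] at h
      obtain ⟨i, hi, hv⟩ := h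
      obtain ⟨N, hN⟩ := ih i hi
      obtain ⟨M, hM⟩ := ihd _ v hv
      refine ⟨max N M, fun g' hg => ?_⟩
      simp only [Part.bind_eq_bind, Part.mem_bind_iff]
      exact ⟨i, hN g' fun i hi => hg i (lt_max_of_lt_left hi),
        hM g' fun i hi => hg i (lt_max_of_lt_right hi)⟩
  | rfind c ih =>
    intro a v h
    obtain ⟨hv, hlt⟩ := Nat.mem_rfind.1 h
    obtain ⟨m, hm, hm0⟩ := (Part.mem_map_iff _).1 hv
    obtain ⟨N, hN⟩ := ih _ m hm
    -- The search also runs `c` at every `j < v`. Induction on `k` merges their separate uses into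
    -- one bound; nothing is known to converge past `v`.
    have key : ∀ k, ∃ N', ∀ j < k, j < v → ∀ g' : ℕ → ℕ, (∀ i < N', g' i = g i) →
        ∃ b, b ∈ c.eval g' (Nat.pair a j) ∧ decide (b = 0) = false := by
      intro k
      induction k with
      | zero => exact ⟨0, fun j hj => absurd hj (Nat.not_lt_zero j)⟩
      | succ k ihk =>
        obtain ⟨N', hN'⟩ := ihk
        by_cases hk : k < v
        · obtain ⟨b, hb, hb0⟩ := (Part.mem_map_iff _).1 (hlt hk)
          obtain ⟨M, hM⟩ := ih _ b hb
          refine ⟨max N' M, fun j hj hjv g' hg => ?_⟩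
          rcases Nat.lt_succ_iff_lt_or_eq.1 hj with hj | rfl
          · exact hN' j hj hjv g' fun i hi => hg i (lt_max_of_lt_left hi)
          · exact ⟨b, hM g' fun i hi => hg i (lt_max_of_lt_right hi), hb0⟩
        · exact ⟨N', fun j hj hjv => hN' j (by omega) hjv⟩
    obtain ⟨N', hN'⟩ := key v
    refine ⟨max N N', fun g' hg => ?_⟩
    exact Nat.mem_rfind.2 ⟨(Part.mem_map_iff _).2
      ⟨m, hN g' fun i hi => hg i (lt_max_of_lt_left hi), hm0⟩, fun {j} hj =>
      (Part.mem_map_iff _).2 (hN' j hj hj g' fun i hi => hg i (lt_max_of_lt_right hi))⟩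

/-- The value of a functional on an initial segment depends on finitely much of the oracle. -/
theorem OracleCode.eval_use_lt (c : OracleCode) (g f : ℕ → ℕ)
    (h : ∀ m, c.eval g m = Part.some (f m)) (M : ℕ) :
    ∃ N, ∀ g' f' : ℕ → ℕ, (∀ i < N, g' i = g i) → (∀ m, c.eval g' m = Part.some (f' m)) →
      ∀ m < M, f' m = f m := by
  induction M with
  | zero => exact ⟨0, fun _ _ _ _ m hm => absurd hm (Nat.not_lt_zero m)⟩
  | succ M ih =>
    obtain ⟨N, hN⟩ := ih
    obtain ⟨N', hN'⟩ := c.eval_use g M (f M) (by simp [h])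
    refine ⟨max N N', fun g' f' hg hf m hm => ?_⟩
    rcases Nat.lt_succ_iff_lt_or_eq.1 hm with hm | rfl
    · exact hN g' f' (fun i hi => hg i (lt_max_of_lt_left hi)) hf m hm
    · have := hN' g' fun i hi => hg i (lt_max_of_lt_right hi)
      simpa [hf, eq_comm] using this

/-! ### Presentations of fields by structures with universe `ℕ` -/

/-- The bijection `e` is an isomorphism of the structure `A` with the field `F`. -/
def Presents (A : Mod fieldLang) {F : Type} [Field F] (e : ℕ ≃ F) : Prop :=
  ∀ {n : ℕ} (R : fieldLang.Relations n) (a : Fin n → ℕ),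
    (fieldStructure F).RelMap R (e ∘ a) ↔ A.RelMap R a

theorem exists_presents_of_equiv {A : Mod fieldLang} {F : Type} [Field F]
    (f : @FirstOrder.Language.Equiv fieldLang ℕ F A (fieldStructure F)) :
    ∃ e : ℕ ≃ F, Presents A e :=
  ⟨_, fun R a => @FirstOrder.Language.Equiv.map_rel' fieldLang ℕ F A (fieldStructure F) f _ R a⟩

theorem Presents.nonempty_equiv {A : Mod fieldLang} {F : Type} [Field F] {e : ℕ ≃ F}
    (h : Presents A e) :
    Nonempty (@FirstOrder.Language.Equiv fieldLang ℕ F A (fieldStructure F)) :=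
  ⟨@FirstOrder.Language.Equiv.mk fieldLang ℕ F A (fieldStructure F) e
    (fun f => Empty.elim f) (fun R a => h R a)⟩

theorem mem_FD_iff {r : ℕ} {A : Mod fieldLang} :
    A ∈ FD r ↔ ∃ (F : Type) (_ : Field F) (_ : CharZero F) (e : ℕ ≃ F),
      Algebra.trdeg ℚ F = r ∧ Presents A e := by
  constructor
  · rintro ⟨F, hF, hc, hr, ⟨f⟩⟩
    obtain ⟨e, he⟩ := exists_presents_of_equiv f
    exact ⟨F, hF, hc, e, hr, he⟩
  · rintro ⟨F, hF, hc, e, hr, he⟩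
    exact ⟨F, hF, hc, hr, he.nonempty_equiv⟩

/-- The structure with universe `ℕ` obtained from a field by a bijection. -/
abbrev presented {F : Type} [Field F] (e : ℕ ≃ F) : Mod fieldLang where
  funMap := fun f => Empty.elim f
  RelMap := fun R a => (fieldStructure F).RelMap R (e ∘ a)

theorem presents_presented {F : Type} [Field F] (e : ℕ ≃ F) : Presents (presented e) e :=
  fun _ _ => Iff.rfl

section Presents

variable {A B : Mod fieldLang} {F G : Type} [Field F] [Field G] {e : ℕ ≃ F} {e' : ℕ ≃ G}

theorem Presents.zero_iff (h : Presents A e) (a : ℕ) :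
    A.RelMap FieldRel.zero ![a] ↔ e a = 0 := (h FieldRel.zero ![a]).symm

theorem Presents.one_iff (h : Presents A e) (a : ℕ) :
    A.RelMap FieldRel.one ![a] ↔ e a = 1 := (h FieldRel.one ![a]).symm

theorem Presents.add_iff (h : Presents A e) (a b c : ℕ) :
    A.RelMap FieldRel.add ![a, b, c] ↔ e a + e b = e c := (h FieldRel.add ![a, b, c]).symm

theorem Presents.mul_iff (h : Presents A e) (a b c : ℕ) :
    A.RelMap FieldRel.mul ![a, b, c] ↔ e a * e b = e c := (h FieldRel.mul ![a, b, c]).symm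

/-- Injective ring homomorphisms preserve and reflect atomic formulas. -/
theorem relMap_comp_ringHom {E : Type} [Field E] (f : E →+* F) (k : E →+* G) {n : ℕ}
    (R : fieldLang.Relations n) (a : Fin n → E) :
    (fieldStructure F).RelMap R (f ∘ a) ↔ (fieldStructure G).RelMap R (k ∘ a) := by
  cases R with
  | zero =>
    change f _ = 0 ↔ k _ = 0
    simp
  | one =>
    change f _ = 1 ↔ k _ = 1
    rw [map_eq_one_iff f f.injective, map_eq_one_iff k k.injective]
  | add =>
    change f _ + f _ = f _ ↔ k _ + k _ = k _
    rw [← map_add, ← map_add, f.injective.eq_iff, k.injective.eq_iff]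
  | mul =>
    change f _ * f _ = f _ ↔ k _ * k _ = k _
    rw [← map_mul, ← map_mul, f.injective.eq_iff, k.injective.eq_iff]

theorem iso_iff_nonempty_ringEquiv (hA : Presents A e) (hB : Presents B e') :
    Iso A B ↔ Nonempty (F ≃+* G) := by
  constructor
  · rintro ⟨f⟩
    let k : ℕ ≃ ℕ := @FirstOrder.Language.Equiv.toEquiv fieldLang ℕ ℕ A B f
    have hf : ∀ {n} (R : fieldLang.Relations n) (a : Fin n → ℕ),
        B.RelMap R (k ∘ a) ↔ A.RelMap R a := fun R a =>
      @FirstOrder.Language.Equiv.map_rel' fieldLang ℕ ℕ A B f _ R a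
    have hcomp : ∀ a b c : ℕ, k ∘ ![a, b, c] = ![k a, k b, k c] := by
      intro a b c
      ext i
      fin_cases i <;> rfl
    refine ⟨⟨(e.symm.trans k).trans e', fun x y => ?_, fun x y => ?_⟩⟩
    · have := hf FieldRel.mul ![e.symm x, e.symm y, e.symm (x * y)]
      rw [hcomp, hA.mul_iff, hB.mul_iff] at this
      exact (this.2 (by simp)).symm
    · have := hf FieldRel.add ![e.symm x, e.symm y, e.symm (x + y)]
      rw [hcomp, hA.add_iff, hB.add_iff] at this
      exact (this.2 (by simp)).symm
  · rintro ⟨f⟩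
    refine ⟨@FirstOrder.Language.Equiv.mk fieldLang ℕ ℕ A B ((e.trans f.toEquiv).trans e'.symm)
      (fun f => Empty.elim f) (fun R a => ?_)⟩
    rw [← hA R a, ← hB R]
    have : e' ∘ ((e.trans f.toEquiv).trans e'.symm).toFun ∘ a = f ∘ e ∘ a := by
      ext i
      simp
    rw [this]
    exact relMap_comp_ringHom (f : F →+* G) (RingHom.id F) R (e ∘ a)

end Presents

/-! ### Finite pieces of diagrams -/

theorem diagram_encode {L : FirstOrder.Language.{0, 0}} [ComputableRelational L] (A : Mod L)
    {n : ℕ} (R : L.Relations n) (a : Fin n → ℕ) :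
    diagram A (Encodable.encode ((⟨n, R⟩ : Σ n, L.Relations n), List.ofFn a)) = 1 ↔
      A.RelMap R a := by
  unfold diagram
  split_ifs with h
  · obtain ⟨S, b, h, hb⟩ := h
    have h := Encodable.encode_injective h
    rw [Prod.mk.injEq] at h
    obtain ⟨rfl, h⟩ := h
    rw [List.ofFn_injective h]
    simpa using hb
  · simp only [false_iff]
    exact fun hR => h ⟨⟨n, R⟩, a, rfl, hR⟩

/-- A code exceeds every constant in its sentence, so codes below `N` mention only constants below
`N`. -/
theorem lt_encode_of_mem {a : ℕ} : ∀ {l : List ℕ}, a ∈ l → a < Encodable.encode l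
  | b :: l, h => by
    rw [Encodable.encode_list_cons, Nat.lt_succ_iff]
    rcases List.mem_cons.1 h with rfl | h
    · exact Nat.left_le_pair _ _
    · exact (lt_encode_of_mem h).le.trans (Nat.right_le_pair _ _)

/-- Structures that agree on the atomic sentences with constants below `N` have diagrams that
agree below `N`. -/
theorem diagram_eq_of_lt {L : FirstOrder.Language.{0, 0}} [ComputableRelational L] {A B : Mod L}
    {N : ℕ} (h : ∀ {n} (R : L.Relations n) (a : Fin n → ℕ), (∀ i, a i < N) →
      (A.RelMap R a ↔ B.RelMap R a)) {m : ℕ} (hm : m < N) : diagram A m = diagram B m := by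
  unfold diagram
  congr 1
  refine propext (exists_congr fun R => exists_congr fun a => and_congr_right fun hma => ?_)
  refine h R.2 a fun i => lt_of_le_of_lt ?_ hm
  rw [hma, Encodable.encode_prod_val]
  exact (lt_encode_of_mem (List.mem_ofFn.2 ⟨i, rfl⟩)).le.trans (Nat.right_le_pair _ _)

theorem exists_bound_relMap_iff {L : FirstOrder.Language.{0, 0}} [ComputableRelational L]
    {n : ℕ} (R : L.Relations n) (a : Fin n → ℕ) :
    ∃ M, ∀ A B : Mod L, (∀ m < M, diagram B m = diagram A m) → (B.RelMap R a ↔ A.RelMap R a) :=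
  ⟨_, fun A B h => by
    rw [← diagram_encode A, ← diagram_encode B, h _ (Nat.lt_succ_self _)]⟩


/-! ### Roots of polynomials are recognized by finite pieces of the diagram -/

open Polynomial in
/-- The polynomials whose value at `x` is computed, in the field presented by `A`, from a finite
piece of the diagram of `A`. -/
def finitelyDetermined {A : Mod fieldLang} {F : Type} [Field F] {e : ℕ ≃ F} (hA : Presents A e)
    (x : ℕ) : Subring ℤ[X] where
  carrier := {p | ∃ M, ∀ (B : Mod fieldLang) (G : Type) (_ : Field G) (e' : ℕ ≃ G),
    Presents B e' → (∀ m < M, diagram B m = diagram A m) →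
      e' (e.symm (aeval (e x) p)) = aeval (e' x) p}
  zero_mem' := by
    obtain ⟨M, hM⟩ := exists_bound_relMap_iff (L := fieldLang) FieldRel.zero ![e.symm 0]
    refine ⟨M, fun B G _ e' hB h => ?_⟩
    simpa [hA.zero_iff, hB.zero_iff] using hM A B h
  one_mem' := by
    obtain ⟨M, hM⟩ := exists_bound_relMap_iff (L := fieldLang) FieldRel.one ![e.symm 1]
    refine ⟨M, fun B G _ e' hB h => ?_⟩
    have := hM A B h
    rw [hA.one_iff, hB.one_iff] at this
    simpa using this
  add_mem' := by
    rintro p q ⟨M₁, h₁⟩ ⟨M₂, h₂⟩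
    obtain ⟨M, hM⟩ := exists_bound_relMap_iff (L := fieldLang) FieldRel.add
      ![e.symm (aeval (e x) p), e.symm (aeval (e x) q), e.symm (aeval (e x) (p + q))]
    refine ⟨max M (max M₁ M₂), fun B G _ e' hB h => ?_⟩
    have := hM A B fun m hm => h m (by simp [hm])
    rw [hA.add_iff, hB.add_iff, h₁ B G _ e' hB fun m hm => h m (by simp [hm]),
      h₂ B G _ e' hB fun m hm => h m (by simp [hm])] at this
    rw [map_add (aeval (e' x)), this.2 (by simp)]
  mul_mem' := by
    rintro p q ⟨M₁, h₁⟩ ⟨M₂, h₂⟩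
    obtain ⟨M, hM⟩ := exists_bound_relMap_iff (L := fieldLang) FieldRel.mul
      ![e.symm (aeval (e x) p), e.symm (aeval (e x) q), e.symm (aeval (e x) (p * q))]
    refine ⟨max M (max M₁ M₂), fun B G _ e' hB h => ?_⟩
    have := hM A B fun m hm => h m (by simp [hm])
    rw [hA.mul_iff, hB.mul_iff, h₁ B G _ e' hB fun m hm => h m (by simp [hm]),
      h₂ B G _ e' hB fun m hm => h m (by simp [hm])] at this
    rw [map_mul (aeval (e' x)), this.2 (by simp)]
  neg_mem' := by
    rintro p ⟨M₁, h₁⟩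
    -- Negation is not a symbol: `-p` is recovered from `p + (-p) = 0`, which requires locating zero
    -- as well.
    obtain ⟨M₀, h₀⟩ := exists_bound_relMap_iff (L := fieldLang) FieldRel.zero ![e.symm 0]
    obtain ⟨M, hM⟩ := exists_bound_relMap_iff (L := fieldLang) FieldRel.add
      ![e.symm (aeval (e x) p), e.symm (aeval (e x) (-p)), e.symm 0]
    refine ⟨max M (max M₀ M₁), fun B G _ e' hB h => ?_⟩
    have hz := h₀ A B fun m hm => h m (by simp [hm])
    rw [hA.zero_iff, hB.zero_iff] at hz
    have := hM A B fun m hm => h m (by simp [hm])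
    rw [hA.add_iff, hB.add_iff, h₁ B G _ e' hB fun m hm => h m (by simp [hm]),
      hz.2 (by simp)] at this
    exact (eq_neg_of_add_eq_zero_right (this.2 (by simp))).trans (map_neg (aeval (e' x)) p).symm

open Polynomial in
-- A subring of `ℤ[X]` containing `X` is everything.
theorem mem_finitelyDetermined {A : Mod fieldLang} {F : Type} [Field F] {e : ℕ ≃ F}
    (hA : Presents A e) (x : ℕ) (p : ℤ[X]) : p ∈ finitelyDetermined hA x := by
  have hX : (X : ℤ[X]) ∈ finitelyDetermined hA x :=
    ⟨0, fun B G _ e' _ _ => by simp⟩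
  induction p using Polynomial.induction_on' with
  | add p q hp hq => exact add_mem hp hq
  | monomial n a =>
    rw [← C_mul_X_pow_eq_monomial, show (C a : ℤ[X]) = (a : ℤ[X]) by simp]
    exact mul_mem (intCast_mem _ a) (pow_mem hX n)

open Polynomial in
theorem exists_bound_aeval_eq_zero {A : Mod fieldLang} {F : Type} [Field F] {e : ℕ ≃ F}
    (hA : Presents A e) {x : F} {p : ℤ[X]} (hx : aeval x p = 0) :
    ∃ M, ∀ (B : Mod fieldLang) (G : Type) (_ : Field G) (e' : ℕ ≃ G), Presents B e' →
      (∀ m < M, diagram B m = diagram A m) → ∃ y : G, aeval y p = 0 := by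
  obtain ⟨M, hM⟩ := mem_finitelyDetermined hA (e.symm x) p
  -- The polynomial `0` ensures that the number naming zero in `F` names zero in `G`.
  obtain ⟨M₀, h₀⟩ := mem_finitelyDetermined hA (e.symm x) 0
  refine ⟨max M M₀, fun B G _ e' hB h => ⟨e' (e.symm x), ?_⟩⟩
  rw [← hM B G _ e' hB fun m hm => h m (by simp [hm])]
  have := h₀ B G _ e' hB fun m hm => h m (by simp [hm])
  simpa [hx] using this

/-! ### Fields with the same existential theory -/

/-- Every finite subset of `F` lies in a subfield that embeds in `G`. -/
def LocallyEmbeds (F G : Type) [Field F] [Field G] : Prop :=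
  ∀ S : Finset F, ∃ E : Subfield F, (S : Set F) ⊆ E ∧ Nonempty (E →+* G)

/-- The embedding prescribes `e'` injectively on the numbers below `N`; being a finite partial
injection, it extends to a bijection of `ℕ` with `G`. -/
theorem LocallyEmbeds.exists_diagram_eq {F G : Type} [Field F] [Field G] (h : LocallyEmbeds F G)
    {A : Mod fieldLang} {e : ℕ ≃ F} (hA : Presents A e) (e₀ : ℕ ≃ G) (N : ℕ) :
    ∃ e' : ℕ ≃ G, ∀ m < N, diagram (presented e') m = diagram A m := by
  classical
  obtain ⟨E, hS, ⟨φ⟩⟩ := h ((Finset.range N).image e)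
  have hE : ∀ a < N, e a ∈ E := fun a ha =>
    hS (Finset.mem_coe.2 (Finset.mem_image_of_mem _ (Finset.mem_range.2 ha)))
  obtain ⟨e', he'⟩ := Cardinal.extend_function_of_lt (s := Set.Iio N) (α := ℕ) (β := G)
    ⟨fun a => φ ⟨e a, hE a a.2⟩, fun a b hab => by
      simpa [Subtype.ext_iff] using φ.injective hab⟩
    ((Cardinal.lt_aleph0_iff_set_finite.2 (Set.finite_Iio N)).trans_eq Cardinal.mk_nat.symm) ⟨e₀⟩
  refine ⟨e', fun m hm => diagram_eq_of_lt (fun R a ha => ?_) hm⟩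
  have h₁ : e' ∘ a = φ ∘ fun i => (⟨e (a i), hE _ (ha i)⟩ : E) := by
    ext i
    exact he' ⟨a i, ha i⟩
  rw [← hA R a]
  change (fieldStructure G).RelMap R (e' ∘ a) ↔ _
  rw [h₁]
  exact (relMap_comp_ringHom E.subtype φ R _).symm

open Polynomial in
/-- A polynomial with a root in the image of a field has a root in the image of every field of the
same existential theory. -/
theorem IsTCEmbedding.exists_root {r s : ℕ} {Φ : FD r → FD s} (hΦ : IsTCEmbedding Φ) {A B : FD r}
    {F G F' G' : Type} [Field F] [Field G] [Field F'] [Field G'] {e : ℕ ≃ F} {e₀ : ℕ ≃ G}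
    {u : ℕ ≃ F'} {v : ℕ ≃ G'} (hA : Presents A.1 e) (hB : Presents B.1 e₀)
    (hu : Presents (Φ A).1 u) (hv : Presents (Φ B).1 v) (h : LocallyEmbeds F G) {p : ℤ[X]}
    {x : F'} (hx : aeval x p = 0) : ∃ y : G', aeval y p = 0 := by
  obtain ⟨⟨c, hc⟩, hiso⟩ := hΦ
  obtain ⟨M, hM⟩ := exists_bound_aeval_eq_zero hu hx
  obtain ⟨N, hN⟩ := c.eval_use_lt _ _ (hc A) M
  obtain ⟨e', he'⟩ := h.exists_diagram_eq hA e₀ N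
  have hBB' : Iso B.1 (presented e') :=
    (iso_iff_nonempty_ringEquiv hB (presents_presented e')).2 ⟨RingEquiv.refl G⟩
  -- `Φ B'` agrees with `Φ A` below `M`, so it has the root, and it is isomorphic to `Φ B` because
  -- `B'` is isomorphic to `B`.
  let B' : FD r := ⟨presented e', FD_isIsoClosed r _ _ hBB' B.2⟩
  obtain ⟨H, _, _, w, -, hw⟩ := mem_FD_iff.1 (Φ B').2
  obtain ⟨y, hy⟩ := hM _ H _ w hw (hN _ _ he' (hc B'))
  obtain ⟨f⟩ := (iso_iff_nonempty_ringEquiv hv hw).1 ((hiso B B').1 hBB')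
  refine ⟨f.symm y, ?_⟩
  have := aeval_algHom_apply (f.symm : H →+* G').toIntAlgHom y p
  rw [hy, map_zero] at this
  exact this

open Polynomial in
/-- Algebraic extensions of `ℚ` are determined by the integer polynomials with roots in them. -/
theorem nonempty_ringEquiv_of_exists_root_iff {F G : Type} [Field F] [Field G] [CharZero F]
    [CharZero G] [Algebra.IsAlgebraic ℚ F] [Algebra.IsAlgebraic ℚ G]
    (h : ∀ p : ℤ[X], (∃ x : F, aeval x p = 0) ↔ ∃ y : G, aeval y p = 0) :
    Nonempty (F ≃+* G) := by
  -- Clearing denominators multiplies by a nonzero integer and keeps the roots.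
  have key : ∀ (K : Type) [Field K] [CharZero K] (p : ℚ[X]) (x : K),
      aeval x (IsLocalization.integerNormalization (nonZeroDivisors ℤ) p) = 0 ↔
        aeval x p = 0 := by
    intro K _ _ p x
    obtain ⟨b, hb₀, hb⟩ := IsLocalization.integerNormalization_spec (nonZeroDivisors ℤ) p
    rw [← aeval_map_algebraMap ℚ, hb, map_zsmul, smul_eq_zero]
    simp [nonZeroDivisors.ne_zero hb₀]
  obtain ⟨f⟩ := Field.nonempty_algEquiv_of_aeval_eq_zero_eq (F := ℚ) (E := F) (K := G) <| by
    ext p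
    have := h (IsLocalization.integerNormalization (nonZeroDivisors ℤ) p)
    simpa only [key, Set.mem_ofPred_eq] using this
  exact ⟨f⟩

/-- A Turing-computable embedding in the algebraic extensions of `ℚ` identifies fields of the same
existential theory. -/
theorem IsTCEmbedding.nonempty_ringEquiv {r : ℕ} {Φ : FD r → FD 0} (hΦ : IsTCEmbedding Φ)
    {F G : Type} [Field F] [Field G] [CharZero F] [CharZero G] [Countable F] [Countable G]
    (hF : Algebra.trdeg ℚ F = r) (hG : Algebra.trdeg ℚ G = r)
    (hFG : LocallyEmbeds F G) (hGF : LocallyEmbeds G F) : Nonempty (F ≃+* G) := by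
  obtain ⟨e⟩ : Nonempty (ℕ ≃ F) := nonempty_equiv_of_countable
  obtain ⟨e₀⟩ : Nonempty (ℕ ≃ G) := nonempty_equiv_of_countable
  let A : FD r := ⟨presented e, mem_FD_iff.2 ⟨F, _, ‹_›, e, hF, presents_presented e⟩⟩
  let B : FD r := ⟨presented e₀, mem_FD_iff.2 ⟨G, _, ‹_›, e₀, hG, presents_presented e₀⟩⟩
  obtain ⟨F', _, _, u, hF', hu⟩ := mem_FD_iff.1 (Φ A).2
  obtain ⟨G', _, _, v, hG', hv⟩ := mem_FD_iff.1 (Φ B).2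
  have hA : Presents A.1 e := presents_presented e
  have hB : Presents B.1 e₀ := presents_presented e₀
  -- Degree zero makes the image fields algebraic, hence determined by their roots.
  have := trdeg_eq_zero_iff.1 (hF'.trans Nat.cast_zero)
  have := trdeg_eq_zero_iff.1 (hG'.trans Nat.cast_zero)
  have key : Nonempty (F' ≃+* G') := nonempty_ringEquiv_of_exists_root_iff fun p =>
    ⟨fun ⟨_, hx⟩ => hΦ.exists_root hA hB hu hv hFG hx,
      fun ⟨_, hx⟩ => hΦ.exists_root hB hA hv hu hGF hx⟩
  exact (iso_iff_nonempty_ringEquiv hA hB).1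
    ((hΦ.2 A B).2 ((iso_iff_nonempty_ringEquiv hu hv).2 key))


/-! ### Two fields of transcendence degree one -/

section

variable (K : Type) [Field K]

open Polynomial in
variable {K} in
-- The equation says `P / Q = (p / q) ^ N` in lowest terms, so `P` and `p ^ N` divide each other.
theorem natDegree_eq_mul_of_mul_pow_eq {P Q p q : K[X]} (hPQ : IsCoprime P Q)
    (hpq : IsCoprime p q) (N : ℕ) (h : P * q ^ N = Q * p ^ N) :
    P.natDegree = N * p.natDegree := by
  have h₁ : P ∣ p ^ N := hPQ.dvd_of_dvd_mul_left (Dvd.intro _ h)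
  have h₂ : p ^ N ∣ P := hpq.pow.dvd_of_dvd_mul_right (Dvd.intro_left _ h.symm)
  rw [← natDegree_pow]
  exact natDegree_eq_of_degree_eq
    (degree_eq_degree_of_associated (associated_of_dvd_dvd h₁ h₂))

open Polynomial in
variable {K} in
/-- The only elements of `K(X)` with a `2 ^ n`-th root for every `n` are constants. -/
theorem isAlgebraic_of_forall_exists_pow_eq {f : RatFunc K}
    (h : ∀ n : ℕ, ∃ g : RatFunc K, g ^ 2 ^ n = f) : IsAlgebraic K f := by
  have key : ∀ n : ℕ, 2 ^ n ∣ f.num.natDegree ∧ 2 ^ n ∣ f.denom.natDegree := by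
    intro n
    obtain ⟨g, hg⟩ := h n
    have hmul : f.num * g.denom ^ 2 ^ n = f.denom * g.num ^ 2 ^ n := by
      apply RatFunc.algebraMap_injective K
      have hfd := RatFunc.algebraMap_ne_zero (K := K) f.denom_ne_zero
      have hgd := RatFunc.algebraMap_ne_zero (K := K) g.denom_ne_zero
      have h₁ := hg
      rw [← RatFunc.num_div_denom g, ← RatFunc.num_div_denom f, div_pow,
        div_eq_div_iff (pow_ne_zero _ hgd) hfd] at h₁
      simp only [map_mul, map_pow]
      linear_combination -h₁
    exact ⟨⟨_, natDegree_eq_mul_of_mul_pow_eq f.isCoprime_num_denom g.isCoprime_num_denom _ hmul⟩,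
      ⟨_, natDegree_eq_mul_of_mul_pow_eq f.isCoprime_num_denom.symm g.isCoprime_num_denom.symm _
        hmul.symm⟩⟩
  -- Take `n = d`: `2 ^ d` exceeds `d`.
  have hzero : ∀ d : ℕ, (∀ n : ℕ, 2 ^ n ∣ d) → d = 0 := fun d hd =>
    Nat.eq_zero_of_dvd_of_lt (hd d) d.lt_two_pow_self
  have hnum := eq_C_of_natDegree_eq_zero (hzero _ fun n => (key n).1)
  have hden := eq_C_of_natDegree_eq_zero (hzero _ fun n => (key n).2)
  rw [← RatFunc.num_div_denom f, hnum, hden]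
  simp only [RatFunc.algebraMap_C, ← map_div₀, ← RatFunc.algebraMap_eq_C]
  exact isAlgebraic_algebraMap _

/-- An iterated square root of the variable in the algebraic closure of `K(X)`. -/
noncomputable def rootX : ℕ → AlgebraicClosure (RatFunc K)
  | 0 => algebraMap (RatFunc K) _ RatFunc.X
  | n + 1 => (IsAlgClosed.exists_pow_nat_eq (rootX n) two_pos).choose

theorem rootX_succ_sq (n : ℕ) : rootX K (n + 1) ^ 2 = rootX K n :=
  (IsAlgClosed.exists_pow_nat_eq (rootX K n) two_pos).choose_spec

theorem rootX_add_pow (n k : ℕ) : rootX K (n + k) ^ 2 ^ k = rootX K n := by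
  induction k with
  | zero => simp
  | succ k ih => rw [pow_succ', pow_mul, ← add_assoc, rootX_succ_sq, ih]

theorem transcendental_rootX (n : ℕ) : Transcendental K (rootX K n) := by
  have h : Transcendental K (rootX K 0) :=
    (transcendental_algebraMap_iff (algebraMap (RatFunc K) _).injective).2
      RatFunc.transcendental_X
  intro hn
  apply h
  rw [← rootX_add_pow K 0 n, zero_add]
  exact hn.pow _

open IntermediateField in
/-- The field generated by the iterated square roots of the variable. -/
noncomputable def dyadicField : IntermediateField K (AlgebraicClosure (RatFunc K)) :=
  ⨆ n, K⟮rootX K n⟯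

open IntermediateField in
-- Each root is the square of the next, so the supremum is a directed union.
theorem monotone_adjoin_rootX : Monotone fun n => K⟮rootX K n⟯ :=
  monotone_nat_of_le_succ fun n => by
    rw [adjoin_simple_le_iff, ← rootX_succ_sq K n]
    exact pow_mem (mem_adjoin_simple_self K _) 2

theorem rootX_mem_dyadicField (n : ℕ) : rootX K n ∈ dyadicField K :=
  (le_iSup (fun n => IntermediateField.adjoin K {rootX K n}) n)
    (IntermediateField.mem_adjoin_simple_self K _)

open IntermediateField in
variable {K} in
theorem mem_dyadicField {x : AlgebraicClosure (RatFunc K)} :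
    x ∈ dyadicField K ↔ ∃ n, x ∈ K⟮rootX K n⟯ := by
  rw [dyadicField, ← SetLike.mem_coe, coe_iSup_of_directed (monotone_adjoin_rootX K).directed_le]
  simp

open Polynomial in
instance [Countable K] : Countable (RatFunc K) := by
  have : Function.Surjective fun p : K[X] × K[X] =>
      algebraMap K[X] (RatFunc K) p.1 / algebraMap K[X] (RatFunc K) p.2 :=
    fun f => ⟨(f.num, f.denom), f.num_div_denom⟩
  have : Countable K[X] := Cardinal.mk_le_aleph0_iff.1 (cardinalMk_le_max.trans (by simp))
  exact Function.Surjective.countable ‹_›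

instance [Countable K] : Countable (dyadicField K) := by
  have : Countable (AlgebraicClosure (RatFunc K)) := Cardinal.mk_le_aleph0_iff.1 <|
    (Algebra.IsAlgebraic.cardinalMk_le_max (RatFunc K) _).trans (by simp)
  exact Subtype.val_injective.countable

open Polynomial in
theorem trdeg_ratFunc : Algebra.trdeg K (RatFunc K) = 1 := by
  have : Algebra.IsAlgebraic K[X] (RatFunc K) :=
    IsLocalization.isAlgebraic _ (nonZeroDivisors K[X])
  rw [← trdeg_add_eq K K[X], Polynomial.trdeg_of_isDomain,
    trdeg_eq_zero, add_zero]

theorem trdeg_dyadicField : Algebra.trdeg K (dyadicField K) = 1 := by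
  apply le_antisymm
  · have h : Algebra.trdeg K (AlgebraicClosure (RatFunc K)) = 1 := by
      rw [← trdeg_add_eq K (RatFunc K), trdeg_ratFunc, trdeg_eq_zero, add_zero]
    rw [← h]
    exact trdeg_le_of_injective (dyadicField K).val (dyadicField K).val.injective
  · have : Algebra.Transcendental K (dyadicField K) :=
      ⟨⟨rootX K 0, rootX_mem_dyadicField K 0⟩,
        fun h => transcendental_rootX K 0 (IsAlgebraic.algHom (dyadicField K).val h)⟩
    exact Cardinal.one_le_iff_pos.2 (trdeg_pos K (dyadicField K))

theorem locallyEmbeds_ratFunc_dyadicField : LocallyEmbeds (RatFunc K) (dyadicField K) := by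
  refine fun S => ⟨⊤, fun _ _ => trivial, ⟨?_⟩⟩
  exact (IntermediateField.inclusion
    (le_iSup (fun n => IntermediateField.adjoin K {rootX K n}) 0)).toRingHom.comp
    ((RatFunc.algEquivOfTranscendental _ (transcendental_rootX K 0)).toAlgHom.toRingHom.comp
      (⊤ : Subfield (RatFunc K)).subtype)

open IntermediateField in
-- A finite set lies in a single stage `K⟮rootX K n⟯`, a copy of `K(X)` because its generator is
-- transcendental.
theorem locallyEmbeds_dyadicField_ratFunc : LocallyEmbeds (dyadicField K) (RatFunc K) := by
  classical
  intro S
  obtain ⟨n, hn⟩ : ∃ n, ∀ x ∈ S, (x : AlgebraicClosure (RatFunc K)) ∈ K⟮rootX K n⟯ := by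
    induction S using Finset.induction_on with
    | empty => exact ⟨0, by simp⟩
    | insert a S _ ih =>
      obtain ⟨n, hn⟩ := ih
      obtain ⟨m, hm⟩ := mem_dyadicField.1 a.2
      refine ⟨max m n, fun x hx => ?_⟩
      rcases Finset.mem_insert.1 hx with rfl | hx
      · exact monotone_adjoin_rootX K (le_max_left m n) hm
      · exact monotone_adjoin_rootX K (le_max_right m n) (hn x hx)
  refine ⟨(K⟮rootX K n⟯).toSubfield.comap (dyadicField K).val.toRingHom, fun x hx => hn x hx, ⟨?_⟩⟩
  exact (RatFunc.algEquivOfTranscendental _ (transcendental_rootX K n)).symm.toAlgHom.toRingHom.comp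
    (((dyadicField K).val.toRingHom.restrict _ (K⟮rootX K n⟯).toSubfield fun _ hx => hx))

/-- An isomorphism would carry `X` with all its `2 ^ n`-th roots back into `K(X)`, making `X`
algebraic. -/
theorem isEmpty_algEquiv_ratFunc_dyadicField : IsEmpty (RatFunc K ≃ₐ[K] dyadicField K) := by
  refine ⟨fun f => transcendental_rootX K 0 ?_⟩
  have h : IsAlgebraic K (f.symm ⟨rootX K 0, rootX_mem_dyadicField K 0⟩) :=
    isAlgebraic_of_forall_exists_pow_eq fun n => ⟨f.symm ⟨rootX K n, rootX_mem_dyadicField K n⟩, by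
      rw [← map_pow]
      congr 1
      exact Subtype.ext (by simpa using rootX_add_pow K 0 n)⟩
  simpa using IsAlgebraic.algHom ((dyadicField K).val.comp f.toAlgHom) h

end

/-- Reconciles the `ℚ`-algebra structure coming from characteristic zero with the one coming from `K
= ℚ`. -/
theorem trdeg_eq_of_algebra_rat {F : Type} [Field F] (a b : Algebra ℚ F) :
    @Algebra.trdeg ℚ F _ _ a = @Algebra.trdeg ℚ F _ _ b :=
  congrArg (@Algebra.trdeg ℚ F _ _) (Subsingleton.elim a b)

theorem nonempty_algEquiv_of_ringEquiv {F G : Type} [Field F] [Field G] (_ : Algebra ℚ F)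
    (_ : Algebra ℚ G) (f : F ≃+* G) : Nonempty (F ≃ₐ[ℚ] G) :=
  ⟨AlgEquiv.ofRingEquiv (f := f) (RingHom.map_rat_algebraMap (f : F →+* G))⟩

end TuringEmbedding

open TuringEmbedding in
theorem mainTheorem8 :
    ¬ TuringEmbedding.TCReducible (TuringEmbedding.FD 1) (TuringEmbedding.FD 0) := by
  rintro ⟨Φ, hΦ⟩
  obtain ⟨f⟩ := hΦ.nonempty_ringEquiv
    ((trdeg_eq_of_algebra_rat _ _).trans ((trdeg_ratFunc ℚ).trans Nat.cast_one.symm))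
    ((trdeg_eq_of_algebra_rat _ _).trans ((trdeg_dyadicField ℚ).trans Nat.cast_one.symm))
    (locallyEmbeds_ratFunc_dyadicField ℚ) (locallyEmbeds_dyadicField_ratFunc ℚ)
  exact not_nonempty_iff.2 (isEmpty_algEquiv_ratFunc_dyadicField ℚ)
    (nonempty_algEquiv_of_ringEquiv _ _ f)
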